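/- For $g,z\in\{0,1\}^n$ let $f(g,z)=\min\{i\in\{1,\dots,n\}: g_i\neq z_i\}$ if $g\neq z$, and $f(g,z)=n+1$ if $g=z$. Let $z\in\{0,1\}^n$ be an unknown string accessible by an oracle acting as $O_z|g,b\rangle=|g,b\oplus f(g,z)\rangle$, where $b\in\{0,1\}^m$ with $2^m>n+1$, $f(g,z)$ is written in binary with $m$ bits, and $\oplus$ is bitwise exclusive or. Then every quantum algorithm that outputs $z$ with high probability uses $\Omega(n)$ queries to $O_z$. Precisely: a quantum algorithm with $T$ queries acts on an $n$-bit query register, an $m$-bit answer register and a finite-dimensional workspace. It starts in a fixed basis state $|0^n,0^m,w_0\rangle$, applies a unitary $U_0$, then for $t=1,\dots,T$ applies $O_z$ (as the identity on the workspace) followed by a unitary $U_t$, where $U_0,\dots,U_T$ do not depend on $z$; finally it measures all registers in the computational basis and outputs a fixed function of the outcome. For every fixed success probability $p>0$ there are a constant $c>0$ and an $N\in\mathbb{N}$, depending only on $p$, such that for all $n\ge N$ and all $m$ with $2^m>n+1$, every quantum algorithm that for each $z\in\{0,1\}^n$ outputs $z$ with probability at least $p$ when run with $O_z$ makes $T\ge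 c\,n$ queries. -/

import Mathlib

/-- Bit strings of length `n`, i.e. elements of `{0,1}ⁿ`. The position `i : Fin n` is the index
`i + 1 ∈ {1, …, n}` in the usual numbering. -/
abbrev BitString (n : ℕ) : Type := Fin n → Bool

/-- The first index in `{1, …, n}` at which `g` and `z` differ, and `n + 1` if `g = z`. -/
noncomputable def firstDiff {n : ℕ} (g z : BitString n) : ℕ :=
  if g = z then n + 1 else sInf {k : ℕ | ∃ i : Fin n, g i ≠ z i ∧ k = (i : ℕ) + 1}

/-- The `m`-bit binary representation of a natural number (least significant bit first). -/
def toBits (m k : ℕ) : BitString m := fun j => k.testBit j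

/-- Bitwise exclusive or of two bit strings. -/
def bitXor {m : ℕ} (a b : BitString m) : BitString m := fun j => Bool.xor (a j) (b j)

theorem bitXor_cancel {m : ℕ} (a b : BitString m) : bitXor (bitXor a b) b = a := by
  funext j
  simp [bitXor]

/-- Computational basis labels `(g, b, w)`: an `n`-bit query register, an `m`-bit answer register
and a workspace register. -/
abbrev BasisLabel (n m : ℕ) (W : Type) : Type := BitString n × BitString m × W

/-- The complex Hilbert space of the three registers. -/
abbrev StateSpace (n m : ℕ) (W : Type) [Fintype W] : Type :=
  EuclideanSpace ℂ (BasisLabel n m W)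

/-- Unitary operators on the three registers. -/
abbrev UnitaryOp (n m : ℕ) (W : Type) [Fintype W] : Type :=
  StateSpace n m W ≃ₗᵢ[ℂ] StateSpace n m W

/-- The computational basis vector `|g, b, w⟩`. -/
noncomputable def ket {n m : ℕ} {W : Type} [Fintype W] [DecidableEq W]
    (x : BasisLabel n m W) : StateSpace n m W :=
  EuclideanSpace.single x 1

/-- The permutation `(g, b, w) ↦ (g, b ⊕ f(g, z), w)` of the basis labels, where `f(g, z)` is
the first-difference index, written in binary. -/
noncomputable def oraclePerm {n : ℕ} (m : ℕ) (W : Type) (z : BitString n) :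
    Equiv.Perm (BasisLabel n m W) where
  toFun x := (x.1, bitXor x.2.1 (toBits m (firstDiff x.1 z)), x.2.2)
  invFun x := (x.1, bitXor x.2.1 (toBits m (firstDiff x.1 z)), x.2.2)
  left_inv x := by simp [bitXor_cancel]
  right_inv x := by simp [bitXor_cancel]

/-- The first-difference oracle `O_z`, acting as the identity on the workspace. -/
noncomputable def oracle {n : ℕ} (m : ℕ) (W : Type) [Fintype W] (z : BitString n) :
    UnitaryOp n m W :=
  LinearIsometryEquiv.piLpCongrLeft 2 ℂ ℂ (oraclePerm m W z)

/-- `O_z |g, b, w⟩ = |g, b ⊕ f(g, z), w⟩`. -/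
theorem oracle_ket {n m : ℕ} {W : Type} [Fintype W] [DecidableEq W] (z g : BitString n)
    (b : BitString m) (w : W) :
    oracle m W z (ket (g, b, w)) = ket (g, bitXor b (toBits m (firstDiff g z)), w) := by
  unfold oracle ket
  rw [EuclideanSpace.piLpCongrLeft_single]
  rfl

/-- A quantum query algorithm on an `n`-bit query register, an `m`-bit answer register and a
finite-dimensional workspace. It starts in `|0ⁿ, 0ᵐ, w₀⟩`, applies `U 0`, and then alternates
`queries` times an oracle call with an input-independent unitary (`U 1`, …, `U queries`). Finally
all registers are measured in the computational basis, and `output` of the measured label is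
returned. -/
structure QueryAlgorithm (n m : ℕ) where
  /-- Labels of a basis of the workspace. -/
  W : Type
  [fintypeW : Fintype W]
  [decEqW : DecidableEq W]
  /-- Initial basis state of the workspace. -/
  w₀ : W
  /-- The number of oracle calls. -/
  queries : ℕ
  /-- The input-independent unitaries. Only `U 0`, …, `U queries` are used. -/
  U : ℕ → UnitaryOp n m W
  /-- Classical post-processing of the measurement outcome. -/
  output : BasisLabel n m W → BitString n

attribute [instance] QueryAlgorithm.fintypeW QueryAlgorithm.decEqW

namespace QueryAlgorithm

variable {n m : ℕ}

/-- The state after `t` oracle calls to `O_z` (and the unitary following each of them). -/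
noncomputable def state (A : QueryAlgorithm n m) (z : BitString n) : ℕ → StateSpace n m A.W
  | 0 => A.U 0 (ket (fun _ => false, fun _ => false, A.w₀))
  | t + 1 => A.U (t + 1) (oracle m A.W z (A.state z t))

/-- The state just before the final measurement. -/
noncomputable def finalState (A : QueryAlgorithm n m) (z : BitString n) : StateSpace n m A.W :=
  A.state z A.queries

/-- The probability that the algorithm with oracle `O_z` outputs `z`. -/
noncomputable def successProb (A : QueryAlgorithm n m) (z : BitString n) : ℝ :=
  ∑ x : BasisLabel n m A.W, if A.output x = z then ‖A.finalState z x‖ ^ 2 else 0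

end QueryAlgorithm

/-!
Take the unknown string `z` uniformly at random and keep it in superposition: the `2ⁿ` runs of the
algorithm form one vector `ψ`, the family `z ↦ |ψ_z⟩`, of norm `2^(n/2)`. Let `V k` be the space of
families that depend on the first `k` bits of `z` only. A vector in `V k` describes an algorithm
that knows at most `k` bits, and the norm `a k` of the component of `ψ` orthogonal to `V k`
measures how much more has been learnt.

* The start vector lies in `V 0`, and input-independent unitaries preserve every `V k`.
* A query reveals much only with small amplitude. The first difference of `g` and `z` is determined
  by the first `k` bits of `z` unless `z` agrees with `g` on all of these, and for a family
  `v ∈ V i` with `i ≤ k` the part of `v` where this happens has norm at most `2^(-(k-i)/2) ‖v‖`. So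
  the oracle moves `v` at most that far out of `V k` (`exists_mem_prefixSubspace_oracle`).
* Splitting `ψ` along the filtration `V 0 ≤ V 1 ≤ ⋯` (`norm_orthogonal_map_le`), one query changes
  `a k` to at most `a k + (3/4)^k ‖ψ‖ + ∑_{i<k} (3/4)^(k-1-i) a i`, where `3/4 ≥ 2^(-1/2)` is a
  convenient rational. By induction `a k ≤ 9^T (7/8)^k ‖ψ‖` after `T` queries
  (`norm_orthogonal_jointState_le`).
* A vector `v ∈ V k` leaves `n - k` bits to be guessed, so its average success probability is at most
  `2^(-(n-k))` (`norm_successMap_le_of_mem`).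

Altogether `√p ≤ (3/4)^(n-k) + 9^T (7/8)^k`. With `k = n/2` the right side tends to zero
exponentially in `n` as long as `T < n/68`.
-/

/-! ### Prefixes of bit strings -/

/-- The strings `g` and `z` have the same first `k` bits. -/
def AgreeBelow {n : ℕ} (k : ℕ) (g z : BitString n) : Prop := ∀ j : Fin n, (j : ℕ) < k → g j = z j

instance {n : ℕ} (k : ℕ) (g z : BitString n) : Decidable (AgreeBelow k g z) :=
  inferInstanceAs (Decidable (∀ j : Fin n, (j : ℕ) < k → g j = z j))

theorem AgreeBelow.mono {n k l : ℕ} {g z : BitString n} (h : AgreeBelow l g z) (hkl : k ≤ l) :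
    AgreeBelow k g z := fun j hj => h j (hj.trans_le hkl)

theorem AgreeBelow.symm {n k : ℕ} {g z : BitString n} (h : AgreeBelow k g z) :
    AgreeBelow k z g := fun j hj => (h j hj).symm

theorem AgreeBelow.trans {n k : ℕ} {x y z : BitString n} (h : AgreeBelow k x y)
    (h' : AgreeBelow k y z) : AgreeBelow k x z := fun j hj => (h j hj).trans (h' j hj)

theorem card_agreeBelow {n k : ℕ} (hk : k ≤ n) (g : BitString n) :
    (Finset.univ.filter fun z => AgreeBelow k g z).card = 2 ^ (n - k) := by
  have h : (Finset.univ.filter fun z => AgreeBelow k g z) =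
      Fintype.piFinset fun j : Fin n => if (j : ℕ) < k then {g j} else Finset.univ := by
    ext z
    rw [Finset.mem_filter_univ, Fintype.mem_piFinset]
    refine forall_congr' fun j => ?_
    by_cases hj : (j : ℕ) < k
    · rw [if_pos hj, Finset.mem_singleton]
      exact ⟨fun h => (h hj).symm, fun h _ => h.symm⟩
    · rw [if_neg hj]
      exact ⟨fun _ => Finset.mem_univ _, fun _ h => absurd h hj⟩
  have hcard : (Finset.univ.filter fun j : Fin n => ¬ (j : ℕ) < k).card = n - k := by
    have := Finset.card_filter_add_card_filter_not (s := (Finset.univ : Finset (Fin n)))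
      (fun j => (j : ℕ) < k)
    rw [Fin.card_filter_val_lt, Finset.card_univ, Fintype.card_fin, min_eq_right hk] at this
    omega
  rw [h, Fintype.card_piFinset]
  simp only [apply_ite Finset.card, Finset.card_singleton, Finset.card_univ, Fintype.card_bool]
  rw [Finset.prod_ite, Finset.prod_const_one, one_mul, Finset.prod_const, hcard]

theorem firstDiff_le_of_agreeBelow {n k : ℕ} {g z z' : BitString n} (hz : AgreeBelow k z z')
    (hg : ¬ AgreeBelow k g z) : firstDiff g z' ≤ firstDiff g z := by
  unfold AgreeBelow at hg
  push Not at hg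
  obtain ⟨j, hj, hne⟩ := hg
  have h1 : g ≠ z := fun h => hne (congrFun h j)
  have h2 : g ≠ z' := fun h => hne ((congrFun h j).trans (hz j hj).symm)
  rw [firstDiff, firstDiff, if_neg h1, if_neg h2]
  have hmem : (j : ℕ) + 1 ∈ {k : ℕ | ∃ i : Fin n, g i ≠ z i ∧ k = (i : ℕ) + 1} := ⟨j, hne, rfl⟩
  obtain ⟨i, hi, hik⟩ := Nat.sInf_mem ⟨_, hmem⟩
  have hij := Nat.sInf_le hmem
  refine Nat.sInf_le ⟨i, ?_, hik⟩
  rwa [← hz i (by omega)]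

theorem firstDiff_eq_of_agreeBelow {n k : ℕ} {g z z' : BitString n} (hz : AgreeBelow k z z')
    (hg : ¬ AgreeBelow k g z) : firstDiff g z = firstDiff g z' :=
  le_antisymm (firstDiff_le_of_agreeBelow hz.symm fun h => hg (h.trans hz.symm))
    (firstDiff_le_of_agreeBelow hz hg)

/-! ### Leakage through a filtration of subspaces -/

section Filtration

variable {E : Type*} [NormedAddCommGroup E] [InnerProductSpace ℂ E] [FiniteDimensional ℂ E]

theorem norm_orthogonal_starProjection_le (V : Submodule ℂ E) {v : E} (hv : v ∈ V) (x : E) :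
    ‖Vᗮ.starProjection x‖ ≤ ‖x - v‖ := by
  have h : Vᗮ.starProjection v = 0 := by
    rw [Submodule.starProjection_orthogonal_val, V.starProjection_eq_self_iff.2 hv, sub_self]
  calc ‖Vᗮ.starProjection x‖ = ‖Vᗮ.starProjection (x - v)‖ := by rw [map_sub, h, sub_zero]
    _ ≤ ‖x - v‖ := Submodule.norm_starProjection_apply_le _ _

/-- If `O` moves the vectors of `V i` out of `V k` by at most `q ^ (k - i)` times their norm, then
the distance of `O x` to `V k` is bounded by the distances of `x` to the spaces `V i`, `i ≤ k`: split
`x` as `(x - P k x) + P 0 x + ∑_{i<k} (P (i+1) x - P i x)`, with `P i` the projection to `V i`. -/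
theorem norm_orthogonal_map_le {V : ℕ → Submodule ℂ E} (hV : Monotone V) (O : E ≃ₗᵢ[ℂ] E)
    {q : ℝ} (hq : 0 ≤ q) {k : ℕ}
    (hO : ∀ i ≤ k, ∀ v ∈ V i, ∃ w ∈ V k, ‖O v - w‖ ≤ q ^ (k - i) * ‖v‖) (x : E) :
    ‖(V k)ᗮ.starProjection (O x)‖ ≤ ‖(V k)ᗮ.starProjection x‖ + q ^ k * ‖x‖ +
      ∑ i ∈ Finset.range k, q ^ (k - 1 - i) * ‖(V i)ᗮ.starProjection x‖ := by
  have hO' : ∀ i ≤ k, ∀ v ∈ V i, ‖(V k)ᗮ.starProjection (O v)‖ ≤ q ^ (k - i) * ‖v‖ := by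
    intro i hi v hv
    obtain ⟨w, hw, h⟩ := hO i hi v hv
    exact (norm_orthogonal_starProjection_le _ hw _).trans h
  have hdec : x = (V k)ᗮ.starProjection x + (V 0).starProjection x +
      ∑ i ∈ Finset.range k, ((V (i + 1)).starProjection x - (V i).starProjection x) := by
    rw [Finset.sum_range_sub (fun i => (V i).starProjection x), Submodule.starProjection_orthogonal_val]
    abel
  have hmap : (V k)ᗮ.starProjection (O x) = (V k)ᗮ.starProjection (O ((V k)ᗮ.starProjection x)) +
      (V k)ᗮ.starProjection (O ((V 0).starProjection x)) +
      ∑ i ∈ Finset.range k, (V k)ᗮ.starProjection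
        (O ((V (i + 1)).starProjection x - (V i).starProjection x)) := by
    conv_lhs => rw [hdec]
    simp only [map_add, map_sum]
  rw [hmap]
  refine norm_add₃_le.trans (add_le_add (add_le_add ?_ ?_) ?_)
  · exact (Submodule.norm_starProjection_apply_le _ _).trans (O.norm_map _).le
  · refine (hO' 0 (Nat.zero_le _) _ (Submodule.starProjection_apply_mem _ _)).trans ?_
    rw [Nat.sub_zero]
    exact mul_le_mul_of_nonneg_left (Submodule.norm_starProjection_apply_le _ _) (pow_nonneg hq _)
  · refine (norm_sum_le _ _).trans (Finset.sum_le_sum fun i hi => ?_)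
    rw [Finset.mem_range] at hi
    have hle : V i ≤ V (i + 1) := hV (Nat.le_succ i)
    have hmem : (V i).starProjection x ∈ V (i + 1) := hle (Submodule.starProjection_apply_mem _ _)
    refine (hO' (i + 1) hi _
      (Submodule.sub_mem _ (Submodule.starProjection_apply_mem _ _) hmem)).trans ?_
    rw [show k - (i + 1) = k - 1 - i by omega]
    refine mul_le_mul_of_nonneg_left ?_ (pow_nonneg hq _)
    -- Projecting `x - P i x` to `V (i + 1)` gives the difference `P (i+1) x - P i x`.
    calc ‖(V (i + 1)).starProjection x - (V i).starProjection x‖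
        = ‖(V (i + 1)).starProjection (x - (V i).starProjection x)‖ := by
          rw [map_sub, (V (i + 1)).starProjection_eq_self_iff.2 hmem]
      _ ≤ ‖x - (V i).starProjection x‖ := Submodule.norm_starProjection_apply_le _ _
      _ = ‖(V i)ᗮ.starProjection x‖ := by rw [Submodule.starProjection_orthogonal_val]

end Filtration

/-- With the bounds `b * (7/8)^i` on the distances to all `V i`, a query costs a factor `9`. -/
theorem sum_geometric_le {b c : ℝ} (hb : c ≤ b) (hc : 0 ≤ c) (k : ℕ) :
    b * (7 / 8) ^ k + (3 / 4) ^ k * c +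
      ∑ i ∈ Finset.range k, (3 / 4) ^ (k - 1 - i) * (b * (7 / 8 : ℝ) ^ i) ≤
    9 * b * (7 / 8) ^ k := by
  have h := geom_sum₂_mul (7 / 8 : ℝ) (3 / 4) k
  have hs : ∑ i ∈ Finset.range k, (3 / 4) ^ (k - 1 - i) * (b * (7 / 8 : ℝ) ^ i) =
      b * (8 * ((7 / 8) ^ k - (3 / 4) ^ k)) := by
    rw [← h, show (7 / 8 - 3 / 4 : ℝ) = 1 / 8 by norm_num, mul_left_comm (8 : ℝ),
      show (8 * (1 / 8) : ℝ) = 1 by norm_num, mul_one, Finset.mul_sum]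
    exact Finset.sum_congr rfl fun i _ => by ring
  rw [hs]
  have h1 : (3 / 4 : ℝ) ^ k * c ≤ (3 / 4) ^ k * b := mul_le_mul_of_nonneg_left hb (by positivity)
  have h2 : 0 ≤ (3 / 4 : ℝ) ^ k * b := mul_nonneg (by positivity) (hc.trans hb)
  nlinarith

/-! ### Families of states indexed by the unknown string -/

/-- The Hilbert space of families of states indexed by the unknown string `z`, that is, the tensor
product of the algorithm's registers with a register that holds `z`. -/
abbrev JointSpace (n m : ℕ) (W : Type) [Fintype W] : Type :=
  PiLp 2 fun _ : BitString n => StateSpace n m W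

/-- The families of states that depend on the first `k` bits of `z` only. -/
def prefixSubspace (n m : ℕ) (W : Type) [Fintype W] (k : ℕ) :
    Submodule ℂ (JointSpace n m W) where
  carrier := {v | ∀ z z', AgreeBelow k z z' → v z = v z'}
  add_mem' {v w} hv hw z z' h := by
    rw [PiLp.add_apply, PiLp.add_apply, hv z z' h, hw z z' h]
  zero_mem' _ _ _ := rfl
  smul_mem' c v hv z z' h := by
    rw [PiLp.smul_apply, PiLp.smul_apply, hv z z' h]

/-- The oracle on families: `O_z` acts on the member of index `z`. -/
noncomputable def jointOracle (n m : ℕ) (W : Type) [Fintype W] :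
    JointSpace n m W ≃ₗᵢ[ℂ] JointSpace n m W :=
  LinearIsometryEquiv.piLpCongrRight 2 fun z => oracle m W z

/-- The part of a family in which the measured label makes the algorithm output the index `z`. -/
noncomputable def successMap {n m : ℕ} {W : Type} [Fintype W]
    (out : BasisLabel n m W → BitString n) : JointSpace n m W →ₗ[ℂ] JointSpace n m W where
  toFun v := WithLp.toLp 2 fun z => WithLp.toLp 2 fun x => if out x = z then v z x else 0
  map_add' v w := by
    ext z x
    by_cases h : out x = z <;> simp [h]
  map_smul' c v := by
    ext z x
    by_cases h : out x = z <;> simp [h]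

section Families

variable {n m : ℕ} {W : Type} [Fintype W]

theorem JointSpace.norm_sq_eq (v : JointSpace n m W) : ‖v‖ ^ 2 = ∑ z, ∑ x, ‖v z x‖ ^ 2 := by
  rw [PiLp.norm_sq_eq_of_L2]
  exact Finset.sum_congr rfl fun z _ => EuclideanSpace.norm_sq_eq _

theorem prefixSubspace_mono : Monotone (prefixSubspace n m W) :=
  fun _ _ hkl _ hv z z' h => hv z z' (h.mono hkl)

/-- The entries of a vector of `V k` repeat `2 ^ (n - k)` times. -/
theorem two_pow_mul_norm_sq_le {k : ℕ} (hk : k ≤ n) {v : JointSpace n m W}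
    (hv : v ∈ prefixSubspace n m W k) (g : BitString n) (x : BasisLabel n m W) :
    (2 : ℝ) ^ (n - k) * ‖v g x‖ ^ 2 ≤ ∑ z, ‖v z x‖ ^ 2 := by
  calc (2 : ℝ) ^ (n - k) * ‖v g x‖ ^ 2
      = ∑ z ∈ Finset.univ.filter fun z => AgreeBelow k g z, ‖v g x‖ ^ 2 := by
        rw [Finset.sum_const, card_agreeBelow hk, nsmul_eq_mul]
        push_cast
        rfl
    _ = ∑ z ∈ Finset.univ.filter fun z => AgreeBelow k g z, ‖v z x‖ ^ 2 := by
        refine Finset.sum_congr rfl fun z hz => ?_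
        rw [hv g z (Finset.mem_filter.1 hz).2]
    _ ≤ ∑ z, ‖v z x‖ ^ 2 :=
        Finset.sum_le_sum_of_subset_of_nonneg (Finset.filter_subset _ _) fun _ _ _ => by positivity

theorem oracle_apply (z : BitString n) (φ : StateSpace n m W) (x : BasisLabel n m W) :
    oracle m W z φ x = φ ((oraclePerm m W z).symm x) := rfl

/-- For a vector of `V i`, the part on which the query string agrees with `z` below `k` has at most
the fraction `2 ^ (-(k - i))` of the squared norm. -/
theorem sum_agreeBelow_le {i k : ℕ} (hik : i ≤ k) (hk : k ≤ n) {v : JointSpace n m W}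
    (hv : v ∈ prefixSubspace n m W i) :
    ∑ z, ∑ x : BasisLabel n m W, (if AgreeBelow k x.1 z then ‖v z x‖ ^ 2 else 0) ≤
      (1 / 2 : ℝ) ^ (k - i) * ‖v‖ ^ 2 := by
  rw [JointSpace.norm_sq_eq, Finset.sum_comm, Finset.sum_comm (f := fun z x => ‖v z x‖ ^ 2),
    Finset.mul_sum]
  refine Finset.sum_le_sum fun x _ => ?_
  rw [← Finset.sum_filter]
  have h1 : ∑ z ∈ Finset.univ.filter fun z => AgreeBelow k x.1 z, ‖v z x‖ ^ 2 =
      (2 : ℝ) ^ (n - k) * ‖v x.1 x‖ ^ 2 := by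
    rw [Finset.sum_congr rfl fun z hz => by
      rw [← hv x.1 z ((Finset.mem_filter.1 hz).2.mono hik)], Finset.sum_const,
      card_agreeBelow hk, nsmul_eq_mul]
    push_cast
    rfl
  have h2 := two_pow_mul_norm_sq_le (hik.trans hk) hv x.1 x
  rw [show n - i = (n - k) + (k - i) by omega, pow_add] at h2
  have h3 : (1 / 2 : ℝ) ^ (k - i) * 2 ^ (k - i) = 1 := by
    rw [← mul_pow]
    norm_num
  rw [h1]
  calc (2 : ℝ) ^ (n - k) * ‖v x.1 x‖ ^ 2
      = (1 / 2 : ℝ) ^ (k - i) * 2 ^ (k - i) * (2 ^ (n - k) * ‖v x.1 x‖ ^ 2) := by rw [h3, one_mul]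
    _ = (1 / 2 : ℝ) ^ (k - i) * (2 ^ (n - k) * 2 ^ (k - i) * ‖v x.1 x‖ ^ 2) := by ring
    _ ≤ _ := mul_le_mul_of_nonneg_left h2 (by positivity)

theorem half_pow_le_sq (d : ℕ) : (1 / 2 : ℝ) ^ d ≤ ((3 / 4 : ℝ) ^ d) ^ 2 := by
  rw [← pow_mul, mul_comm, pow_mul]
  exact pow_le_pow_left₀ (by norm_num) (by norm_num) d

/-- The oracle nearly keeps a vector of `V i` in `V k`: deleting the part of its image on which the
query string agrees with `z` below `k` gives a vector of `V k`. -/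
theorem exists_mem_prefixSubspace_oracle {i k : ℕ} (hik : i ≤ k) (hk : k ≤ n)
    {v : JointSpace n m W} (hv : v ∈ prefixSubspace n m W i) :
    ∃ w ∈ prefixSubspace n m W k,
      ‖jointOracle n m W v - w‖ ≤ (3 / 4 : ℝ) ^ (k - i) * ‖v‖ := by
  refine ⟨WithLp.toLp 2 fun z => WithLp.toLp 2 fun x =>
    if AgreeBelow k x.1 z then 0 else oracle m W z (v z) x, ?_, ?_⟩
  · intro z z' h
    ext x
    change (if AgreeBelow k x.1 z then 0 else oracle m W z (v z) x) =
      (if AgreeBelow k x.1 z' then 0 else oracle m W z' (v z') x)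
    by_cases hx : AgreeBelow k x.1 z
    · rw [if_pos hx, if_pos (hx.trans h)]
    · rw [if_neg hx, if_neg fun h' => hx (h'.trans h.symm), oracle_apply, oracle_apply,
        hv z z' (h.mono hik)]
      change v z' (x.1, bitXor x.2.1 (toBits m (firstDiff x.1 z)), x.2.2) =
        v z' (x.1, bitXor x.2.1 (toBits m (firstDiff x.1 z')), x.2.2)
      rw [firstDiff_eq_of_agreeBelow h hx]
  · refine le_of_sq_le_sq ?_ (by positivity)
    rw [mul_pow, JointSpace.norm_sq_eq]
    calc _ = ∑ z, ∑ x : BasisLabel n m W, (if AgreeBelow k x.1 z then ‖v z x‖ ^ 2 else 0) := by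
          refine Finset.sum_congr rfl fun z _ => ?_
          -- The oracle permutes the labels without changing the query string.
          rw [← (oraclePerm m W z).symm.sum_comp
            (fun x : BasisLabel n m W => if AgreeBelow k x.1 z then ‖v z x‖ ^ 2 else 0)]
          refine Finset.sum_congr rfl fun x _ => ?_
          change ‖v z ((oraclePerm m W z).symm x) -
            (if AgreeBelow k x.1 z then 0 else v z ((oraclePerm m W z).symm x))‖ ^ 2 =
            if AgreeBelow k x.1 z then ‖v z ((oraclePerm m W z).symm x)‖ ^ 2 else 0
          split_ifs <;> simp
      _ ≤ (1 / 2 : ℝ) ^ (k - i) * ‖v‖ ^ 2 := sum_agreeBelow_le hik hk hv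
      _ ≤ _ := mul_le_mul_of_nonneg_right (half_pow_le_sq _) (by positivity)

/-- Unitaries that do not depend on `z` do not increase the distance to `V k`. -/
theorem norm_orthogonal_unitary_le (U : UnitaryOp n m W) (k : ℕ)
    (v : JointSpace n m W) :
    ‖(prefixSubspace n m W k)ᗮ.starProjection
      (LinearIsometryEquiv.piLpCongrRight 2 (fun _ => U) v)‖ ≤
    ‖(prefixSubspace n m W k)ᗮ.starProjection v‖ := by
  have hmem := Submodule.starProjection_apply_mem (prefixSubspace n m W k) v
  have hU : LinearIsometryEquiv.piLpCongrRight 2 (fun _ => U)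
      ((prefixSubspace n m W k).starProjection v) ∈ prefixSubspace n m W k :=
    fun z z' h => congrArg U (hmem z z' h)
  refine (norm_orthogonal_starProjection_le _ hU _).trans ?_
  rw [← map_sub, LinearIsometryEquiv.norm_map, Submodule.starProjection_orthogonal_val]

theorem norm_sq_successMap (out : BasisLabel n m W → BitString n) (v : JointSpace n m W) :
    ‖successMap out v‖ ^ 2 = ∑ z, ∑ x, if out x = z then ‖v z x‖ ^ 2 else 0 := by
  rw [JointSpace.norm_sq_eq]
  refine Finset.sum_congr rfl fun z _ => Finset.sum_congr rfl fun x _ => ?_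
  change ‖if out x = z then v z x else 0‖ ^ 2 = _
  split_ifs <;> simp

theorem norm_successMap_le (out : BasisLabel n m W → BitString n) (v : JointSpace n m W) :
    ‖successMap out v‖ ≤ ‖v‖ := by
  refine le_of_sq_le_sq ?_ (norm_nonneg _)
  rw [norm_sq_successMap, JointSpace.norm_sq_eq]
  refine Finset.sum_le_sum fun z _ => Finset.sum_le_sum fun x _ => ?_
  split_ifs
  exacts [le_rfl, by positivity]

/-- Knowing `k` bits, an algorithm guesses the other `n - k` bits with probability at most
`2 ^ (-(n - k))`. -/
theorem norm_successMap_le_of_mem (out : BasisLabel n m W → BitString n) {k : ℕ} (hk : k ≤ n)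
    {v : JointSpace n m W} (hv : v ∈ prefixSubspace n m W k) :
    ‖successMap out v‖ ≤ (3 / 4 : ℝ) ^ (n - k) * ‖v‖ := by
  refine le_of_sq_le_sq ?_ (by positivity)
  have h : ‖successMap out v‖ ^ 2 ≤ (1 / 2 : ℝ) ^ (n - k) * ‖v‖ ^ 2 := by
    rw [norm_sq_successMap, JointSpace.norm_sq_eq, Finset.sum_comm,
      Finset.sum_comm (f := fun z x => ‖v z x‖ ^ 2), Finset.mul_sum]
    refine Finset.sum_le_sum fun x _ => ?_
    rw [Finset.sum_ite_eq, if_pos (Finset.mem_univ _)]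
    have h2 := mul_le_mul_of_nonneg_left (two_pow_mul_norm_sq_le hk hv (out x) x)
      (by positivity : (0 : ℝ) ≤ (1 / 2) ^ (n - k))
    rw [← mul_assoc, ← mul_pow] at h2
    norm_num at h2 ⊢
    exact h2
  rw [mul_pow]
  exact h.trans (mul_le_mul_of_nonneg_right (half_pow_le_sq _) (by positivity))

end Families

/-! ### Progress of a query algorithm -/

namespace QueryAlgorithm

variable {n m : ℕ} (A : QueryAlgorithm n m)

/-- The family of the states reached after `t` queries, one for each unknown string. -/
noncomputable def jointState (t : ℕ) : JointSpace n m A.W := WithLp.toLp 2 fun z => A.state z t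

theorem jointState_succ (t : ℕ) : A.jointState (t + 1) =
    LinearIsometryEquiv.piLpCongrRight 2 (fun _ => A.U (t + 1))
      (jointOracle n m A.W (A.jointState t)) := rfl

theorem norm_state (z : BitString n) (t : ℕ) : ‖A.state z t‖ = 1 := by
  induction t with
  | zero => simp [state, ket]
  | succ t ih => rw [state, LinearIsometryEquiv.norm_map, LinearIsometryEquiv.norm_map, ih]

theorem norm_sq_jointState (t : ℕ) : ‖A.jointState t‖ ^ 2 = 2 ^ n := by
  rw [PiLp.norm_sq_eq_of_L2]
  simp [jointState, norm_state]

theorem norm_jointState_eq (s t : ℕ) : ‖A.jointState s‖ = ‖A.jointState t‖ := by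
  rw [← sq_eq_sq₀ (norm_nonneg _) (norm_nonneg _), norm_sq_jointState, norm_sq_jointState]

theorem norm_orthogonal_jointState_le (t : ℕ) : ∀ k ≤ n,
    ‖(prefixSubspace n m A.W k)ᗮ.starProjection (A.jointState t)‖ ≤
      9 ^ t * ‖A.jointState t‖ * (7 / 8 : ℝ) ^ k := by
  induction t with
  | zero =>
    intro k _
    have h : A.jointState 0 ∈ prefixSubspace n m A.W k := fun _ _ _ => rfl
    refine (norm_orthogonal_starProjection_le _ h _).trans ?_
    rw [sub_self, norm_zero]
    positivity
  | succ t ih =>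
    intro k hk
    rw [A.norm_jointState_eq (t + 1) t, jointState_succ]
    refine (norm_orthogonal_unitary_le _ _ _).trans ?_
    have hstep := norm_orthogonal_map_le (V := prefixSubspace n m A.W) prefixSubspace_mono
      (jointOracle n m A.W) (by norm_num : (0 : ℝ) ≤ 3 / 4)
      (fun i hi v hv => exists_mem_prefixSubspace_oracle hi hk hv) (A.jointState t)
    refine hstep.trans ?_
    have hb : ‖A.jointState t‖ ≤ 9 ^ t * ‖A.jointState t‖ :=
      le_mul_of_one_le_left (norm_nonneg _) (one_le_pow₀ (by norm_num))
    rw [pow_succ', mul_assoc (9 : ℝ)]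
    refine le_trans ?_ (sum_geometric_le hb (norm_nonneg _) k)
    refine add_le_add (add_le_add (ih k hk) le_rfl) (Finset.sum_le_sum fun i hi => ?_)
    exact mul_le_mul_of_nonneg_left (ih i ((Finset.mem_range.1 hi).le.trans hk)) (by positivity)

theorem norm_sq_successMap_jointState :
    ‖successMap A.output (A.jointState A.queries)‖ ^ 2 = ∑ z, A.successProb z :=
  norm_sq_successMap _ _

/-- A uniform success probability `p` is bounded by the chance of guessing the last `n - k` bits plus
the amplitude of knowing more than `k` bits. -/
theorem sqrt_le_of_le_successProb {p : ℝ} (h : ∀ z, p ≤ A.successProb z) {k : ℕ} (hk : k ≤ n) :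
    √p ≤ (3 / 4 : ℝ) ^ (n - k) + 9 ^ A.queries * (7 / 8) ^ k := by
  set ψ := A.jointState A.queries with hψ
  set V := prefixSubspace n m A.W k with hV
  have hsq : ‖ψ‖ ^ 2 = 2 ^ n := A.norm_sq_jointState _
  have hpos : 0 < ‖ψ‖ := by
    refine (norm_nonneg _).lt_of_ne fun h0 => ?_
    rw [← h0] at hsq
    have : (0 : ℝ) < 2 ^ n := by positivity
    norm_num at hsq
    linarith
  have hlow : √p * ‖ψ‖ ≤ ‖successMap A.output ψ‖ := by
    rw [← Real.sqrt_sq hpos.le, ← Real.sqrt_mul' _ (by positivity), hsq]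
    refine Real.sqrt_le_iff.2 ⟨norm_nonneg _, ?_⟩
    rw [hψ, norm_sq_successMap_jointState]
    calc p * 2 ^ n = ∑ _z : BitString n, p := by simp [mul_comm]
      _ ≤ _ := Finset.sum_le_sum fun z _ => h z
  have hup : ‖successMap A.output ψ‖ ≤
      (3 / 4 : ℝ) ^ (n - k) * ‖ψ‖ + 9 ^ A.queries * ‖ψ‖ * (7 / 8) ^ k := by
    rw [← V.starProjection_add_starProjection_orthogonal ψ, map_add,
      V.starProjection_add_starProjection_orthogonal ψ]
    refine (norm_add_le _ _).trans (add_le_add ?_ ?_)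
    · have hmem : V.starProjection ψ ∈ V := Submodule.starProjection_apply_mem V ψ
      refine (norm_successMap_le_of_mem A.output hk hmem).trans ?_
      exact mul_le_mul_of_nonneg_left (Submodule.norm_starProjection_apply_le _ _) (by positivity)
    · exact (norm_successMap_le _ _).trans (A.norm_orthogonal_jointState_le _ k hk)
  refine le_of_mul_le_mul_right ?_ hpos
  linarith

end QueryAlgorithm

/-! ### The lower bound -/

theorem mainTheorem5 (p : ℝ) (hp : 0 < p) :
    ∃ c : ℝ, 0 < c ∧ ∃ N : ℕ, ∀ n : ℕ, N ≤ n → ∀ m : ℕ, n + 1 < 2 ^ m →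
      ∀ A : QueryAlgorithm n m,
        (∀ z : BitString n, p ≤ A.successProb z) → c * (n : ℝ) ≤ (A.queries : ℝ) := by
  obtain ⟨Q, hQ⟩ := exists_pow_lt_of_lt_one (half_pos (Real.sqrt_pos.2 hp))
    (by norm_num : (7 / 8 : ℝ) < 1)
  refine ⟨1 / 68, by norm_num, 4 * Q, fun n hn m _ A h => ?_⟩
  by_contra! hlt
  have hT : 68 * A.queries < n := by
    have : (68 : ℝ) * A.queries < n := by linarith
    exact_mod_cast this
  have hmain := A.sqrt_le_of_le_successProb h (Nat.div_le_self n 2)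
  have hanti : ∀ {a : ℕ}, Q ≤ a → (7 / 8 : ℝ) ^ a ≤ (7 / 8) ^ Q := fun ha =>
    pow_le_pow_of_le_one (by norm_num) (by norm_num) ha
  have h1 : (3 / 4 : ℝ) ^ (n - n / 2) ≤ (7 / 8) ^ Q :=
    (pow_le_pow_left₀ (by norm_num) (by norm_num) _).trans (hanti (by omega))
  -- As `9 ≤ (8/7)^17`, the queries offset at most `17 * queries ≤ n / 4` of the `n / 2` factors.
  have h2 : (9 : ℝ) ^ A.queries * (7 / 8) ^ (n / 2) ≤ (7 / 8) ^ Q := by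
    rw [show n / 2 = 17 * A.queries + (n / 2 - 17 * A.queries) by omega, pow_add, ← mul_assoc,
      pow_mul, ← mul_pow]
    refine (mul_le_of_le_one_left (by positivity) (pow_le_one₀ (by positivity) ?_)).trans
      (hanti (by omega))
    norm_num
  linarith
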